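/- Let $n\ge 0$ and let $g=\sum_{i=1}^n g_i\,\delta_{\xi_i}$ with $g_i>0$ and $0<\xi_1<\dots<\xi_n\le 1$. Call $g$ nondegenerate if all $\xi_i<1$. Write $(f,h)_g=\int_{[0,1]} f h\,dg$ (bilinear), and let $L^2_g$ be the space of complex valued square integrable functions with respect to $g$. For $z\in\mathbb C$ let $\varphi(\cdot;z)$ be the solution on $[0,1]$ of $$-\varphi_{\xi\xi\xi}=z\,g\,\varphi,\qquad \varphi(0)=\varphi_\xi(0)=0,\quad \varphi_{\xi\xi}(0)=1,$$ and for $a\in\{0,1,2\}$ let $\varphi_a^*(\cdot;z)$ be the solution of $\varphi^*_{\xi\xi\xi}=z\,g\,\varphi^*$ for which $(\varphi^*,\varphi^*_\xi,\varphi^*_{\xi\xi})$ at $\xi=1$ equals $(0,0,1)$ if $a=0$, $(0,1,0)$ if $a=1$, and $(1,0,0)$ if $a=2$. (The equations hold in the sense of measures: $\varphi$ is $C^1$ and $d\varphi_{\xi\xi}=-z\varphi\,dg$, respectively $d\varphi^*_{\xi\xi}=z\varphi^*dg$; if $\xi_n=1$, values of second derivatives at $1$ are right-hand limits, i.e. taken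 after the jump at $1$.) The spectrum $\sigma_a$ of type $a$ is the set of all $z\in\mathbb C$ for which $-u_{\xi\xi\xi}=z\,g\,u$, $u(0)=u_\xi(0)=0$ has a nontrivial solution on $[0,1]$ with $u(1)=0$ (type $0$), $u_\xi(1)=0$ (type $1$), $u_{\xi\xi}(1)=0$ (type $2$). Define the type $a$ transform $$\hat f_a(z)=(-1)^a\int_{[0,1]}\varphi_a^*(\xi;z)f(\xi)\,dg(\xi),$$ and let $\nu_a=\sum_{z\in\sigma_a}\delta_z$ be the counting measure on the spectrum. (1) Let $a\in\{0,1,2\}$, and suppose that $g$ is nondegenerate or that $a=2$. Then $\sigma_a$ is finite, $(\varphi_a^*(z),\varphi(z))_g\ne0$ for $z\in\sigma_a$, and the transform $f\mapsto \hat f_a|_{\sigma_a}$ from $L^2_g$ to functions on $\sigma_a$ has the (two-sided) inverse $$F\longmapsto (-1)^a\int F(z)\,\frac{\varphi(\xi;z)}{(\varphi_a^*(z),\varphi(z))_g}\,d\nu_a(z).$$ In particular, for every $f\in L^2_g$ and $g$-almost every $\xi$ (that is, at every $\xi_i$), $$f(\xi)=(-1)^a\int \hat f_a(z)\,\frac{\varphi(\xi;z)}{(\varphi_a^*(z),\varphi(z))_g}\,d\nu_a(z).$$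 (2) In the degenerate as well as in the nondegenerate case, for every $z\in\sigma_2$ we have $\varphi_\xi(1;z)\neq0$ and $b(z):=-\varphi_\xi(1;z)/\partial_z\varphi_{\xi\xi}(1;z)>0$. With $\beta=\sum_{z\in\sigma_2}b(z)\,\delta_z$, the inverse of the type $2$ transform is also given by $$F\longmapsto\int F(z)\,\frac{\varphi(\xi;z)}{\varphi_\xi(1;z)}\,d\beta(z);$$ in particular, for every $f\in L^2_g$ and $g$-almost every $\xi$, $$f(\xi)=\int \hat f_2(z)\,\frac{\varphi(\xi;z)}{\varphi_\xi(1;z)}\,d\beta(z).$$ -/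

import Mathlib

open MeasureTheory Set
open scoped ENNReal

noncomputable section

namespace CubicString

/-- A discrete mass distribution `∑ i, mass i • δ_{pos i}` on the string `[0, 1]`, with positive
masses at points `0 < pos 0 < pos 1 < ⋯ ≤ 1`. The last mass may sit at the right end `1`
(the degenerate case). -/
structure DiscreteString (n : ℕ) where
  pos : Fin n → ℝ
  mass : Fin n → ℝ
  pos_strictMono : StrictMono pos
  pos_pos : ∀ i, 0 < pos i
  pos_le_one : ∀ i, pos i ≤ 1
  mass_pos : ∀ i, 0 < mass i

/-- All masses lie in the open interval `(0, 1)`. -/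
def DiscreteString.Nondegenerate {n : ℕ} (S : DiscreteString n) : Prop :=
  ∀ i, S.pos i < 1

/-- The mass measure `g = ∑ i, g_i δ_{ξ_i}`. -/
def DiscreteString.g {n : ℕ} (S : DiscreteString n) : Measure ℝ :=
  ∑ i, ENNReal.ofReal (S.mass i) • Measure.dirac (S.pos i)

/-- `U = (u, u_ξ, u_ξξ)` solves the equation `u_ξξξ = w g u` on `[0, 1]`, where `g` is a measure:
`u` is differentiable with derivative `u_ξ`, the function `u_ξ` is absolutely continuous with
density `u_ξξ`, and `d u_ξξ = w u dg`, where `u_ξξ` is the right-continuous representative.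
In particular, if `g` has an atom at `1`, then `U 2 1` is the right-hand limit of `u_ξξ` at `1`,
i.e. the value just after the jump. -/
structure IsSolution (g : Measure ℝ) (w : ℂ) (U : Fin 3 → ℝ → ℂ) : Prop where
  deriv_zero : ∀ ξ ∈ Icc (0 : ℝ) 1, HasDerivWithinAt (U 0) (U 1 ξ) (Icc 0 1) ξ
  deriv_one : ∀ ξ ∈ Icc (0 : ℝ) 1, U 1 ξ = U 1 0 + ∫ t in (0 : ℝ)..ξ, U 2 t
  deriv_two : ∀ ξ ∈ Icc (0 : ℝ) 1, U 2 ξ = U 2 0 + w * ∫ t in Ioc 0 ξ, U 0 t ∂g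

/-! ### Existence of solutions of the initial value problems -/

theorem exists_triangular {n : ℕ} (r : Fin n → Fin n → Prop) (hr : WellFounded r)
    (A : Fin n → ℂ) (K : Fin n → Fin n → ℂ) (hK : ∀ i j, ¬ r j i → K i j = 0) :
    ∃ c : Fin n → ℂ, ∀ i, c i = A i + ∑ j, K i j * c j := by
  classical
  let F : (i : Fin n) → ((j : Fin n) → r j i → ℂ) → ℂ :=
    fun i rec => A i + ∑ j, if h : r j i then K i j * rec j h else 0
  refine ⟨hr.fix F, fun i => ?_⟩
  rw [hr.fix_eq]
  simp only [F]
  congr 1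
  refine Finset.sum_congr rfl fun j _ => ?_
  split_ifs with h
  · rfl
  · rw [hK i j h, zero_mul]

theorem hasDerivAt_ramp (x ξ : ℝ) :
    HasDerivAt (fun t : ℝ => (max (t - x) 0) ^ 2 / 2) (max (ξ - x) 0) ξ := by
  rcases lt_trichotomy ξ x with h | h | h
  · rw [max_eq_right (by linarith)]
    refine (hasDerivAt_const ξ (0 : ℝ)).congr_of_eventuallyEq ?_
    filter_upwards [Iio_mem_nhds h] with t ht
    rw [max_eq_right (by linarith [show t < x from ht])]
    simp
  · subst h
    rw [sub_self, max_self, hasDerivAt_iff_isLittleO]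
    simp only [sub_self, max_self, smul_zero, sub_zero]
    have h1 : (fun t : ℝ => (max (t - ξ) 0) ^ 2 / 2 - 0 ^ 2 / 2) =O[nhds ξ]
        fun t => (t - ξ) ^ 2 := by
      refine Asymptotics.IsBigO.of_bound 1 (Filter.Eventually.of_forall fun t => ?_)
      rw [zero_pow two_ne_zero, zero_div, sub_zero, Real.norm_eq_abs, Real.norm_eq_abs, abs_of_nonneg (by positivity),
        abs_of_nonneg (by positivity)]
      rcases max_cases (t - ξ) 0 with ⟨h, _⟩ | ⟨h, _⟩ <;> rw [h] <;> nlinarith [sq_nonneg (t - ξ)]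
    refine h1.trans_isLittleO ?_
    have h2 : (fun t : ℝ => (t - ξ) ^ 2) = (fun s : ℝ => s ^ 2) ∘ fun t => t - ξ := rfl
    have h3 : (fun t : ℝ => t - ξ) = (fun s : ℝ => s) ∘ fun t => t - ξ := rfl
    rw [h2, h3]
    have h4 : (fun s : ℝ => s ^ 2) =o[nhds 0] fun s : ℝ => s := by
      simpa using Asymptotics.isLittleO_pow_pow (𝕜 := ℝ) (m := 1) (n := 2) (by norm_num)
    refine h4.comp_tendsto ?_
    have : Continuous fun t : ℝ => t - ξ := by fun_prop
    simpa [Function.comp_def] using this.tendsto ξ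
  · rw [max_eq_left (by linarith)]
    have h1 : HasDerivAt (fun t : ℝ => (t - x) ^ 2 / 2) (ξ - x) ξ := by
      have := (((hasDerivAt_id ξ).sub_const x).pow 2).div_const 2
      refine this.congr_deriv ?_
      simp
    refine h1.congr_of_eventuallyEq ?_
    filter_upwards [Ioi_mem_nhds h] with t ht
    rw [max_eq_left (by linarith [show x < t from ht])]

theorem integral_step {x ξ : ℝ} (hx : 0 < x) (hξ : 0 ≤ ξ) :
    (∫ t in (0 : ℝ)..ξ, (if x ≤ t then (1 : ℂ) else 0)) = ((max (ξ - x) 0 : ℝ) : ℂ) := by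
  rw [intervalIntegral.integral_of_le hξ]
  have h1 : (fun t : ℝ => if x ≤ t then (1 : ℂ) else 0) = (Ici x).indicator fun _ => (1 : ℂ) := by
    ext t; simp [indicator]
  rw [h1, setIntegral_indicator measurableSet_Ici]
  have h2 : Ioc 0 ξ ∩ Ici x = Icc x ξ := by
    ext t
    simp only [mem_inter_iff, mem_Ioc, mem_Ici, mem_Icc]
    constructor
    · rintro ⟨⟨_, h⟩, h'⟩; exact ⟨h', h⟩
    · rintro ⟨h, h'⟩; exact ⟨⟨by linarith, h'⟩, h⟩
  rw [h2]
  simp [Measure.real, Real.volume_Icc, ENNReal.toReal_ofReal']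

theorem DiscreteString.setIntegral_g {n : ℕ} (S : DiscreteString n) (f : ℝ → ℂ) {s : Set ℝ}
    (hs : MeasurableSet s) :
    (∫ t in s, f t ∂S.g) =
      ∑ i, (S.mass i : ℂ) * (open Classical in if S.pos i ∈ s then f (S.pos i) else 0) := by
  classical
  rw [← integral_indicator hs, DiscreteString.g, integral_finsetSum_measure]
  · refine Finset.sum_congr rfl fun i _ => ?_
    rw [integral_smul_measure, integral_dirac, ENNReal.toReal_ofReal (S.mass_pos i).le,
      indicator_apply]
    simp
  · intro i _
    exact (integrable_dirac (by simp)).smul_measure ENNReal.ofReal_ne_top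

theorem DiscreteString.isSolution_of_coeff {n : ℕ} (S : DiscreteString n) (w p q r : ℂ)
    (c : Fin n → ℂ)
    (hc : ∀ i, c i = p + q * S.pos i + r * (S.pos i) ^ 2 / 2 +
      ∑ j, w * S.mass j * c j * (((max (S.pos i - S.pos j) 0) ^ 2 / 2 : ℝ) : ℂ)) :
    IsSolution S.g w
      ![fun ξ => p + q * ξ + r * (ξ : ℂ) ^ 2 / 2 +
          ∑ j, w * S.mass j * c j * (((max (ξ - S.pos j) 0) ^ 2 / 2 : ℝ) : ℂ),
        fun ξ => q + r * ξ + ∑ j, w * S.mass j * c j * ((max (ξ - S.pos j) 0 : ℝ) : ℂ),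
        fun ξ => r + ∑ j, w * S.mass j * c j * (if S.pos j ≤ ξ then (1 : ℂ) else 0)] where
  deriv_zero := by
    intro ξ _
    refine HasDerivAt.hasDerivWithinAt ?_
    simp only [Matrix.cons_val_zero, Matrix.cons_val_one]
    refine HasDerivAt.add ?_ ?_
    · have h1 : HasDerivAt (fun t : ℝ => (t : ℂ)) 1 ξ := Complex.ofRealCLM.hasDerivAt
      have h2 := ((h1.const_mul q).const_add p).fun_add
        (((h1.fun_pow 2).const_mul r).div_const 2)
      convert h2 using 1
      simp only [Nat.cast_ofNat, Nat.add_one_sub_one, pow_one, mul_one]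
      ring
    · exact HasDerivAt.fun_sum fun j _ =>
        ((hasDerivAt_ramp (S.pos j) ξ).ofReal_comp).const_mul _
  deriv_one := by
    intro ξ hξ
    have hint : ∀ j, IntervalIntegrable
        (fun t : ℝ => w * S.mass j * c j * (if S.pos j ≤ t then (1 : ℂ) else 0)) volume 0 ξ := by
      intro j
      refine IntervalIntegrable.const_mul ?_ _
      have h1 : (fun t : ℝ => if S.pos j ≤ t then (1 : ℂ) else 0) =
          (Ici (S.pos j)).indicator fun _ => (1 : ℂ) := by
        ext t; simp [indicator]
      rw [h1, intervalIntegrable_iff]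
      exact (intervalIntegrable_iff.1 intervalIntegrable_const).indicator measurableSet_Ici
    simp only [Matrix.cons_val_one, Matrix.cons_val]
    rw [intervalIntegral.integral_add (by simp)
      (by simpa [Finset.sum_fn] using IntervalIntegrable.sum Finset.univ fun j _ => hint j),
      intervalIntegral.integral_finsetSum fun j _ => hint j]
    simp only [intervalIntegral.integral_const_mul, integral_step (S.pos_pos _) hξ.1]
    have h0 : ∀ j, max (-S.pos j) 0 = 0 := fun j =>
      max_eq_right (by linarith [S.pos_pos j])
    simp [h0]
    ring
  deriv_two := by
    intro ξ hξ
    simp only [Matrix.cons_val_zero, Matrix.cons_val]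
    rw [S.setIntegral_g _ measurableSet_Ioc]
    have h0 : ∀ j, ¬ S.pos j ≤ 0 := fun j => not_le.2 (S.pos_pos j)
    simp only [h0, if_false, mul_zero, Finset.sum_const_zero, add_zero, Finset.mul_sum]
    congr 1
    refine Finset.sum_congr rfl fun j _ => ?_
    rw [← hc j]
    by_cases h : S.pos j ≤ ξ
    · simp [h, S.pos_pos j]; ring
    · simp [h]

theorem DiscreteString.exists_solution_left {n : ℕ} (S : DiscreteString n) (w : ℂ)
    (v : Fin 3 → ℂ) : ∃ U, IsSolution S.g w U ∧ ∀ k, U k 0 = v k := by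
  obtain ⟨c, hc⟩ := exists_triangular (fun i j : Fin n => i < j) wellFounded_lt
    (fun i => v 0 + v 1 * S.pos i + v 2 * (S.pos i) ^ 2 / 2)
    (fun i j => w * S.mass j * (((max (S.pos i - S.pos j) 0) ^ 2 / 2 : ℝ) : ℂ)) (by
      intro i j hij
      rw [max_eq_right (by linarith [S.pos_strictMono.monotone (not_lt.1 hij)])]
      simp)
  refine ⟨_, S.isSolution_of_coeff w (v 0) (v 1) (v 2) c fun i => ?_, fun k => ?_⟩
  · rw [hc i]
    congr 1
    exact Finset.sum_congr rfl fun j _ => by ring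
  · have h0 : ∀ j, max (-S.pos j) 0 = 0 := fun j =>
      max_eq_right (by linarith [S.pos_pos j])
    have h1 : ∀ j, ¬ S.pos j ≤ 0 := fun j => not_le.2 (S.pos_pos j)
    fin_cases k <;> simp [h0, h1]

theorem DiscreteString.exists_solution_right {n : ℕ} (S : DiscreteString n) (w : ℂ)
    (v : Fin 3 → ℂ) : ∃ U, IsSolution S.g w U ∧ ∀ k, U k 1 = v k := by
  have key : ∀ t : ℝ, (max t 0) ^ 2 / 2 = t ^ 2 / 2 - (max (-t) 0) ^ 2 / 2 := by
    intro t
    rcases le_total t 0 with h | h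
    · rw [max_eq_right h, max_eq_left (by linarith)]; ring
    · rw [max_eq_left h, max_eq_right (by linarith)]; ring
  obtain ⟨c, hc⟩ := exists_triangular (fun i j : Fin n => i > j) wellFounded_gt
    (fun i => v 0 + v 1 * (S.pos i - 1) + v 2 * (S.pos i - 1) ^ 2 / 2)
    (fun i j => -(w * S.mass j * (((max (-(S.pos i - S.pos j)) 0) ^ 2 / 2 : ℝ) : ℂ))) (by
      intro i j hij
      rw [max_eq_right (by linarith [S.pos_strictMono.monotone (not_lt.1 hij)])]
      simp)
  have expand : ∀ ξ : ℝ, (v 0 - v 1 + v 2 / 2 - ∑ j, w * S.mass j * c j * (S.pos j : ℂ) ^ 2 / 2) +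
      (v 1 - v 2 + ∑ j, w * S.mass j * c j * S.pos j) * (ξ : ℂ) +
      (v 2 - ∑ j, w * S.mass j * c j) * (ξ : ℂ) ^ 2 / 2 =
      v 0 + v 1 * (ξ - 1) + v 2 * (ξ - 1) ^ 2 / 2 -
        ∑ j, w * S.mass j * c j * ((ξ - S.pos j) ^ 2 / 2) := by
    intro ξ
    have : ∑ j, w * S.mass j * c j * ((ξ - S.pos j) ^ 2 / 2 : ℂ) =
        (∑ j, w * S.mass j * c j * (S.pos j : ℂ) ^ 2 / 2) -
        (∑ j, w * S.mass j * c j * S.pos j) * ξ + (∑ j, w * S.mass j * c j) * (ξ : ℂ) ^ 2 / 2 := by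
      rw [Finset.sum_mul, Finset.sum_mul, Finset.sum_div, ← Finset.sum_sub_distrib,
        ← Finset.sum_add_distrib]
      exact Finset.sum_congr rfl fun j _ => by ring
    rw [this]
    ring
  refine ⟨_, S.isSolution_of_coeff w
    (v 0 - v 1 + v 2 / 2 - ∑ j, w * S.mass j * c j * (S.pos j : ℂ) ^ 2 / 2)
    (v 1 - v 2 + ∑ j, w * S.mass j * c j * S.pos j)
    (v 2 - ∑ j, w * S.mass j * c j) c fun i => ?_, fun k => ?_⟩
  · rw [expand, sub_add, ← Finset.sum_sub_distrib, hc i,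
      sub_eq_add_neg _ (Finset.sum _ _), ← Finset.sum_neg_distrib]
    congr 1
    refine Finset.sum_congr rfl fun j _ => ?_
    rw [key (S.pos i - S.pos j)]
    push_cast
    ring
  · have h0 : ∀ j, max (1 - S.pos j) 0 = 1 - S.pos j := fun j =>
      max_eq_left (by linarith [S.pos_le_one j])
    have h1 : ∀ j, S.pos j ≤ 1 := S.pos_le_one
    fin_cases k
    · have := expand 1
      simp only [Fin.zero_eta, Matrix.cons_val_zero, this, h0]
      push_cast
      simp
    · simp only [Fin.mk_one, Matrix.cons_val_one, Matrix.cons_val_zero, h0]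
      push_cast
      simp only [mul_sub, Finset.sum_sub_distrib, mul_one]
      ring
    · simp [h1]

/-! ### The string, its adjoint and the spectra -/

variable {n : ℕ} (S : DiscreteString n)

/-- `S.phi z = (φ, φ_ξ, φ_ξξ)(· ; z)`, where `φ` is the solution of the initial value problem
`-φ_ξξξ = z g φ`, `φ(0) = φ_ξ(0) = 0`, `φ_ξξ(0) = 1`. -/
def DiscreteString.phi (z : ℂ) : Fin 3 → ℝ → ℂ :=
  (S.exists_solution_left (-z) ![0, 0, 1]).choose

theorem DiscreteString.phi_spec (z : ℂ) :
    IsSolution S.g (-z) (S.phi z) ∧ ∀ k, S.phi z k 0 = (![0, 0, 1] : Fin 3 → ℂ) k :=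
  (S.exists_solution_left (-z) ![0, 0, 1]).choose_spec

/-- The vector `(φ*(1), φ*_ξ(1), φ*_ξξ(1))` of the adjoint initial value problem of type `a`. -/
def adjointInitial (a : Fin 3) : Fin 3 → ℂ :=
  ![![0, 0, 1], ![0, 1, 0], ![1, 0, 0]] a

/-- `S.phiStar a z = (φ*_a, φ*_{a,ξ}, φ*_{a,ξξ})(· ; z)`, where `φ*_a` is the solution of the
adjoint initial value problem of type `a`: `φ*_ξξξ = z g φ*` with data at `1`. -/
def DiscreteString.phiStar (a : Fin 3) (z : ℂ) : Fin 3 → ℝ → ℂ :=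
  (S.exists_solution_right z (adjointInitial a)).choose

theorem DiscreteString.phiStar_spec (a : Fin 3) (z : ℂ) :
    IsSolution S.g z (S.phiStar a z) ∧ ∀ k, S.phiStar a z k 1 = adjointInitial a k :=
  (S.exists_solution_right z (adjointInitial a)).choose_spec

/-- The spectrum of type `a`: all complex `z` for which the boundary value problem
`-u_ξξξ = z g u`, `u(0) = u_ξ(0) = 0`, with `u(1) = 0` (type `0`), `u_ξ(1) = 0` (type `1`) or
`u_ξξ(1) = 0` (type `2`), has a nontrivial solution. -/
def DiscreteString.spectrum (a : Fin 3) : Set ℂ :=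
  {z | ∃ U, IsSolution S.g (-z) U ∧ U 0 0 = 0 ∧ U 1 0 = 0 ∧ U a 1 = 0 ∧
    ∃ ξ ∈ Icc (0 : ℝ) 1, U 0 ξ ≠ 0}

/-- The symmetric bilinear form `(f, h)_g = ∫₀¹ f h dg`. -/
def DiscreteString.pairing (f h : ℝ → ℂ) : ℂ :=
  ∫ ξ in Icc (0 : ℝ) 1, f ξ * h ξ ∂S.g

/-- The generalized Fourier transform of type `a`. -/
def DiscreteString.fourier (a : Fin 3) (f : ℝ → ℂ) (z : ℂ) : ℂ :=
  (-1) ^ (a : ℕ) * ∫ ξ in Icc (0 : ℝ) 1, S.phiStar a z 0 ξ * f ξ ∂S.g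

/-- The measure `ν_a = ∑ δ_z`, the sum running over the spectrum of type `a`. -/
def DiscreteString.nu (a : Fin 3) : Measure ℂ :=
  Measure.sum fun z : S.spectrum a => Measure.dirac (z : ℂ)

/-- `b(z) = -φ_ξ(1; z) / φ_{ξξz}(1; z)`. -/
def DiscreteString.weight (z : ℂ) : ℂ :=
  -(S.phi z 1 1) / deriv (fun s : ℂ => S.phi s 2 1) z

/-- The measure `β = ∑ b(z) δ_z`, the sum running over the spectrum of type `2`. (The numbers
`b(z)` are positive there.) -/
def DiscreteString.beta : Measure ℂ :=
  Measure.sum fun z : S.spectrum 2 =>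
    ENNReal.ofReal (S.weight z).re • Measure.dirac (z : ℂ)

/-- `ξ ↦ (-1)^a ∫ F(z) φ(ξ; z) / (φ*_a(z), φ(z))_g dν_a(z)`. -/
def DiscreteString.invFourier (a : Fin 3) (F : ℂ → ℂ) (ξ : ℝ) : ℂ :=
  (-1) ^ (a : ℕ) *
    ∫ z, F z * (S.phi z 0 ξ / S.pairing (S.phiStar a z 0) (S.phi z 0)) ∂S.nu a

/-- `ξ ↦ ∫ F(z) φ(ξ; z) / φ_ξ(1; z) dβ(z)`. -/
def DiscreteString.invFourierBeta (F : ℂ → ℂ) (ξ : ℝ) : ℂ :=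
  ∫ z, F z * (S.phi z 0 ξ / S.phi z 1 1) ∂S.beta

end CubicString

end

/-!
Between the masses `φ` is a quadratic polynomial, and at a mass `φ_ξξ` jumps by a multiple of
`-z φ`. Hence `φ_a(1; z)`, the value at `1` of the `a`-th derivative, is a real polynomial `P_a` in
`-z` whose zeros give `σ_a`. In the nondegenerate case, and always for `a = 2`, its degree is the
number `n` of masses.

If `x` is not real, or if the recursion is run over the dual numbers at a real `x`, multiplication
by the spectral parameter turns the real plane in one direction, and the vectors
`P_0(x), P_1(x), P_2(x)` of the plane stay cyclically ordered along the string. In particular they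
do not vanish, so every zero of `P_a` is real and simple, and the ordering also says that the
Wronskian `P_1 P_2' - P_1' P_2` is positive, which is the positivity of `b`.

Lagrange's identity gives `(z' - z) (φ*_a(z'), φ(z))_g = (-1)^a (φ_a(1; z) - φ_a(1; z'))`. So
`φ*_a(z')` and `φ(z)` are orthogonal for distinct points of `σ_a`, whereas on the diagonal the
pairing is the derivative of `φ_a(1; ·)` up to sign, and this is nonzero. Thus the matrix of the
transform has a right inverse, and this is a left inverse as well when `σ_a` has `n` points.
-/

namespace CubicString

open Polynomial

theorem intervalIntegrable_setIntegral_Ioc {E : Type*} [NormedAddCommGroup E] [NormedSpace ℝ E]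
    {g : Measure ℝ} [SFinite g] {f : ℝ → E} {a b : ℝ} (hab : a ≤ b)
    (hf : IntegrableOn f (Ioc a b) g) :
    IntervalIntegrable (fun x => ∫ t in Ioc a x, f t ∂g) volume a b := by
  let φ : ℝ × ℝ → E := {p : ℝ × ℝ | p.2 ≤ p.1}.indicator fun p => f p.2
  have hφ : AEStronglyMeasurable φ ((volume.restrict (Ioc a b)).prod (g.restrict (Ioc a b))) :=
    hf.aestronglyMeasurable.comp_snd.indicator (measurableSet_le measurable_snd measurable_fst)
  have hφ_eq : ∀ x ∈ Ioc a b, ∫ t in Ioc a b, φ (x, t) ∂g = ∫ t in Ioc a x, f t ∂g := by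
    intro x hx
    have hsec : (fun t => φ (x, t)) = (Iic x).indicator f := rfl
    rw [hsec, setIntegral_indicator measurableSet_Iic, Ioc_inter_Iic, min_eq_right hx.2]
  rw [intervalIntegrable_iff_integrableOn_Ioc_of_le hab]
  refine Integrable.of_bound (hφ.integral_prod_right'.congr ?_) (∫ t in Ioc a b, ‖f t‖ ∂g) ?_
  · filter_upwards [ae_restrict_mem measurableSet_Ioc] with x hx using hφ_eq x hx
  · filter_upwards [ae_restrict_mem measurableSet_Ioc] with x hx
    exact (norm_integral_le_integral_norm f).trans <| setIntegral_mono_set hf.norm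
      (.of_forall fun t => norm_nonneg (f t)) (Ioc_subset_Ioc_right hx.2).eventuallyLE

section LocallyFinite

variable {g : Measure ℝ} {w : ℂ} {U : Fin 3 → ℝ → ℂ} {x y t : ℝ}

theorem IsSolution.continuousOn_zero (h : IsSolution g w U) : ContinuousOn (U 0) (Icc 0 1) :=
  fun ξ hξ => (h.deriv_zero ξ hξ).continuousWithinAt

variable [IsLocallyFiniteMeasure g]

theorem IsSolution.integrableOn_Ioc (h : IsSolution g w U) (hx : 0 ≤ x) (hy : y ≤ 1) :
    IntegrableOn (U 0) (Ioc x y) g :=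
  h.continuousOn_zero.integrableOn_Icc.mono_set
    (Ioc_subset_Icc_self.trans (Icc_subset_Icc hx hy))

theorem IsSolution.two_eq_add (h : IsSolution g w U) (hx : 0 ≤ x) (hxy : x ≤ y) (hy : y ≤ 1) :
    U 2 y = U 2 x + w * ∫ t in Ioc x y, U 0 t ∂g := by
  rw [h.deriv_two y ⟨hx.trans hxy, hy⟩, h.deriv_two x ⟨hx, hxy.trans hy⟩,
    ← Ioc_union_Ioc_eq_Ioc hx hxy, setIntegral_union (Ioc_disjoint_Ioc_of_le le_rfl)
      measurableSet_Ioc (h.integrableOn_Ioc le_rfl (hxy.trans hy)) (h.integrableOn_Ioc hx hy)]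
  ring

theorem IsSolution.intervalIntegrable_two (h : IsSolution g w U) :
    IntervalIntegrable (U 2) volume 0 1 := by
  have hint := intervalIntegrable_setIntegral_Ioc zero_le_one (h.integrableOn_Ioc le_rfl le_rfl)
  refine ((intervalIntegrable_const (c := U 2 0)).add (hint.const_mul w)).congr fun t ht => ?_
  rw [uIoc_of_le zero_le_one] at ht
  exact (h.deriv_two t (Ioc_subset_Icc_self ht)).symm

theorem IsSolution.one_eq_add (h : IsSolution g w U) (hx : 0 ≤ x) (hxy : x ≤ y) (hy : y ≤ 1) :
    U 1 y = U 1 x + ∫ t in x..y, U 2 t := by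
  have hint : ∀ a ∈ Icc (0 : ℝ) 1, ∀ b ∈ Icc (0 : ℝ) 1, IntervalIntegrable (U 2) volume a b :=
    fun a ha b hb => h.intervalIntegrable_two.mono_set <| by
      rw [uIcc_of_le zero_le_one]
      exact uIcc_subset_Icc ha hb
  have hx' : x ∈ Icc (0 : ℝ) 1 := ⟨hx, hxy.trans hy⟩
  have hy' : y ∈ Icc (0 : ℝ) 1 := ⟨hx.trans hxy, hy⟩
  have h0 : (0 : ℝ) ∈ Icc (0 : ℝ) 1 := left_mem_Icc.2 zero_le_one
  rw [h.deriv_one y hy', h.deriv_one x hx', add_assoc,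
    intervalIntegral.integral_add_adjacent_intervals (hint 0 h0 x hx') (hint x hx' y hy')]

theorem IsSolution.one_eq_of_two_eq_const (h : IsSolution g w U) (hx : 0 ≤ x) (hy : y ≤ 1)
    (h2 : ∀ t ∈ Ico x y, U 2 t = U 2 x) (ht : t ∈ Icc x y) :
    U 1 t = U 1 x + U 2 x * (t - x) := by
  have hconst : ∫ s in x..t, U 2 s = ∫ _ in x..t, U 2 x :=
    intervalIntegral.integral_congr_Ioo_of_le ht.1 fun s hs => h2 s ⟨hs.1.le, hs.2.trans_le ht.2⟩
  rw [h.one_eq_add hx ht.1 (ht.2.trans hy), hconst, intervalIntegral.integral_const,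
    Complex.real_smul, Complex.ofReal_sub, mul_comm]

theorem IsSolution.zero_eq_of_two_eq_const (h : IsSolution g w U) (hx : 0 ≤ x) (hy : y ≤ 1)
    (h2 : ∀ t ∈ Ico x y, U 2 t = U 2 x) (ht : t ∈ Icc x y) :
    U 0 t = U 0 x + U 1 x * (t - x) + U 2 x * ((t - x) ^ 2 / 2) := by
  have hpoly : ∀ s : ℝ, HasDerivAt
      (fun s : ℝ => U 0 x + U 1 x * ((s : ℂ) - x) + U 2 x * (((s : ℂ) - x) ^ 2 / 2))
      (U 1 x + U 2 x * (s - x)) s := by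
    intro s
    have hs : HasDerivAt (fun s : ℝ => (s : ℂ) - x) 1 s := Complex.ofRealCLM.hasDerivAt.sub_const _
    refine (((hs.const_mul (U 1 x)).const_add (U 0 x)).fun_add
      (((hs.fun_pow 2).div_const 2).const_mul (U 2 x))).congr_deriv ?_
    simp only [Nat.cast_ofNat, Nat.add_one_sub_one, pow_one, mul_one]
    ring
  refine eq_of_has_deriv_right_eq (fun s hs => ?_) (fun s _ => (hpoly s).hasDerivWithinAt)
    (h.continuousOn_zero.mono (Icc_subset_Icc hx hy))
    (fun s _ => (hpoly s).continuousAt.continuousWithinAt) (by simp) t ht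
  have hs01 : s ∈ Ico (0 : ℝ) 1 := ⟨hx.trans hs.1, hs.2.trans_le hy⟩
  rw [← h.one_eq_of_two_eq_const hx hy h2 (Ico_subset_Icc_self hs)]
  exact (h.deriv_zero s (Ico_subset_Icc_self hs01)).mono_of_mem_nhdsWithin
    (Icc_mem_nhdsGE_of_mem hs01)

theorem IsSolution.zero_eq_of_ae_eq_zero (h : IsSolution g w U) (h0 : U 0 =ᵐ[g] 0)
    (ht : t ∈ Icc (0 : ℝ) 1) : U 0 t = U 0 0 + U 1 0 * t + U 2 0 * (t ^ 2 / 2) := by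
  have h2 : ∀ s ∈ Ico (0 : ℝ) 1, U 2 s = U 2 0 := fun s hs => by
    rw [h.deriv_two s (Ico_subset_Icc_self hs),
      setIntegral_eq_zero_of_ae_eq_zero (h0.mono fun _ h _ => h), mul_zero, add_zero]
  simpa using h.zero_eq_of_two_eq_const le_rfl le_rfl h2 ht

end LocallyFinite

section Transfer

variable {M N A : Type*} [AddCommGroup M] [Module ℝ M] [AddCommGroup N] [Module ℝ N]
  [CommRing A] [Algebra ℝ A]

/-- The Taylor shift `(u, u', u'')(ξ) ↦ (u, u', u'')(ξ + l)` of a function `u` with `u''' = 0`. -/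
noncomputable def propagate (l : ℝ) (s : Fin 3 → M) : Fin 3 → M :=
  ![s 0 + l • s 1 + (l ^ 2 / 2) • s 2, s 1 + l • s 2, s 2]

/-- The jump `u'' ↦ u'' + m • T u` of the second derivative at a point of mass `m`. The linear map
`T` takes the place of multiplication by the spectral parameter. -/
def jump (T : M →ₗ[ℝ] M) (m : ℝ) (s : Fin 3 → M) : Fin 3 → M :=
  ![s 0, s 1, s 2 + m • T (s 0)]

theorem map_propagate (E : M →ₗ[ℝ] N) (l : ℝ) (s : Fin 3 → M) :
    E ∘ propagate l s = propagate l (E ∘ s) := by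
  funext a
  fin_cases a <;> simp [propagate]

theorem map_jump {E : M →ₗ[ℝ] N} {T : M →ₗ[ℝ] M} {T' : N →ₗ[ℝ] N}
    (hE : ∀ x, E (T x) = T' (E x)) (m : ℝ) (s : Fin 3 → M) :
    E ∘ jump T m s = jump T' m (E ∘ s) := by
  funext a
  fin_cases a <;> simp [jump, hE]

/-- The bilinear concomitant `u v'' - u' v' + u'' v` of the operator `d³/dξ³`: the boundary term
that appears when `∫ (u''' v + u v''')` is integrated by parts. -/
def concomitant (u v : Fin 3 → A) : A :=
  u 0 * v 2 - u 1 * v 1 + u 2 * v 0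

theorem concomitant_propagate (l : ℝ) (u v : Fin 3 → A) :
    concomitant (propagate l u) (propagate l v) = concomitant u v := by
  have hl : algebraMap ℝ A (l ^ 2 / 2) * 2 = algebraMap ℝ A l ^ 2 := by
    rw [← map_ofNat (algebraMap ℝ A) 2, ← map_mul, ← map_pow, div_mul_cancel₀ _ two_ne_zero]
  simp only [concomitant, propagate, Algebra.smul_def, Matrix.cons_val]
  linear_combination u 2 * v 2 * hl

theorem concomitant_jump (w w' : A) (m : ℝ) (u v : Fin 3 → A) :
    concomitant (jump (LinearMap.mulLeft ℝ w) m u) (jump (LinearMap.mulLeft ℝ w') m v) =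
      concomitant u v + (w + w') * m • (u 0 * v 0) := by
  simp only [concomitant, jump, LinearMap.mulLeft_apply, Algebra.smul_def, Matrix.cons_val]
  ring

end Transfer

section Interlacing

/-- The standard area form on the plane `ℝ × ℝ`. -/
def bracket : ℝ × ℝ →ₗ[ℝ] ℝ × ℝ →ₗ[ℝ] ℝ :=
  LinearMap.mk₂ ℝ (fun u v => u.1 * v.2 - u.2 * v.1)
    (fun u u' v => by simp only [Prod.fst_add, Prod.snd_add]; ring)
    (fun c u v => by simp only [Prod.smul_fst, Prod.smul_snd, smul_eq_mul]; ring)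
    (fun u v v' => by simp only [Prod.fst_add, Prod.snd_add]; ring)
    (fun c u v => by simp only [Prod.smul_fst, Prod.smul_snd, smul_eq_mul]; ring)

theorem bracket_apply (u v : ℝ × ℝ) : bracket u v = u.1 * v.2 - u.2 * v.1 := rfl

theorem bracket_self (u : ℝ × ℝ) : bracket u u = 0 := by
  rw [bracket_apply]
  ring

theorem bracket_swap (u v : ℝ × ℝ) : bracket u v = -bracket v u := by
  simp only [bracket_apply]
  ring

theorem bracket_mul_bracket (u v x y : ℝ × ℝ) :
    bracket u x * bracket v y = bracket u v * bracket x y + bracket u y * bracket v x := by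
  simp only [bracket_apply]
  ring

variable {T : ℝ × ℝ →ₗ[ℝ] ℝ × ℝ}

theorem bracket_map (T : ℝ × ℝ →ₗ[ℝ] ℝ × ℝ) (u v : ℝ × ℝ) :
    bracket (T u) (T v) = bracket (T (1, 0)) (T (0, 1)) * bracket u v := by
  have hT (x : ℝ × ℝ) : T x = x.1 • T (1, 0) + x.2 • T (0, 1) := by
    rw [← map_smul, ← map_smul, ← map_add]
    simp
  rw [hT u, hT v]
  simp only [map_add, map_smul, LinearMap.add_apply, LinearMap.smul_apply, smul_eq_mul,
    bracket_apply]
  ring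

theorem bracket_map_nonneg (hT : ∀ v, 0 ≤ bracket v (T v)) {u v : ℝ × ℝ}
    (huv : 0 ≤ bracket u v) : 0 ≤ bracket (T u) (T v) := by
  -- The quadratic form `x ↦ bracket (x, 1) (T (x, 1))` has a nonpositive discriminant, whence
  -- `det T ≥ 0`.
  rw [bracket_map]
  refine mul_nonneg ?_ huv
  rcases h1 : T (1, 0) with ⟨a, c⟩
  rcases h2 : T (0, 1) with ⟨b, d⟩
  have hquad (x : ℝ) : 0 ≤ c * (x * x) + (d - a) * x + -b := by
    have hx : T (x, 1) = x • T (1, 0) + T (0, 1) := by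
      rw [← map_smul, ← map_add]
      simp
    have h := hT (x, 1)
    rw [hx, h1, h2] at h
    simp only [bracket_apply, Prod.fst_add, Prod.snd_add, Prod.smul_mk, smul_eq_mul] at h
    linarith
  have hdisc := discrim_le_zero hquad
  rw [discrim] at hdisc
  rw [bracket_apply]
  nlinarith [sq_nonneg (a + d)]

/-- The plane vectors `p, q, r = s 0, s 1, s 2` follow one another counterclockwise, where `p` and
`q` may be parallel, and `T p` and `T q` lie less than a half turn beyond `r`. When `T` turns no
vector clockwise, this condition survives the transfer along the string. -/
structure Interlaced (T : ℝ × ℝ →ₗ[ℝ] ℝ × ℝ) (s : Fin 3 → ℝ × ℝ) : Prop where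
  zero_one : 0 ≤ bracket (s 0) (s 1)
  zero_two : 0 < bracket (s 0) (s 2)
  one_two : 0 < bracket (s 1) (s 2)
  two_map_zero : 0 < bracket (s 2) (T (s 0))
  two_map_one : 0 < bracket (s 2) (T (s 1))

variable {s : Fin 3 → ℝ × ℝ}

theorem Interlaced.ne_zero (h : Interlaced T s) (a : Fin 3) : s a ≠ 0 := by
  intro ha
  have h02 := h.zero_two
  have h12 := h.one_two
  fin_cases a <;> simp_all

theorem Interlaced.propagate (hT : ∀ v, 0 ≤ bracket v (T v)) (h : Interlaced T s) {l : ℝ}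
    (hl : 0 ≤ l) : Interlaced T (propagate l s) := by
  obtain ⟨h01, h02, h12, h2T0, h2T1⟩ := h
  have h2T2 := hT (s 2)
  constructor <;>
    simp only [CubicString.propagate, Matrix.cons_val, map_add, map_smul, LinearMap.add_apply,
      LinearMap.smul_apply, smul_eq_mul, bracket_self, mul_zero, add_zero]
  · have hsum : 0 ≤ bracket (s 0) (s 1) + l * bracket (s 0) (s 2) +
        l ^ 2 / 2 * bracket (s 1) (s 2) := by positivity
    rw [bracket_swap (s 2)]
    linarith
  all_goals positivity

theorem Interlaced.jump (hT : ∀ v, 0 ≤ bracket v (T v)) (h : Interlaced T s) {m : ℝ}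
    (hm : 0 ≤ m) : Interlaced T (jump T m s) := by
  obtain ⟨h01, h02, h12, h2T0, h2T1⟩ := h
  have h0T0 := hT (s 0)
  have h1T0 : 0 ≤ bracket (s 1) (T (s 0)) := by
    refine nonneg_of_mul_nonneg_right ?_ h02
    rw [bracket_mul_bracket]
    positivity
  have hT0T1 := bracket_map_nonneg hT h01
  constructor <;>
    simp only [CubicString.jump, Matrix.cons_val, map_add, map_smul, LinearMap.add_apply,
      LinearMap.smul_apply, smul_eq_mul, bracket_self, mul_zero, add_zero]
  all_goals positivity

theorem Interlaced.initial {v : ℝ × ℝ} (hv : 0 < bracket v (T v)) {l m : ℝ} (hl : 0 < l)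
    (hm : 0 < m) : Interlaced T (CubicString.jump T m (CubicString.propagate l ![0, 0, v])) := by
  constructor <;>
    simp only [CubicString.jump, CubicString.propagate, Matrix.cons_val, map_add, map_smul,
      LinearMap.add_apply, LinearMap.smul_apply, smul_eq_mul, bracket_self, smul_zero,
      mul_zero, zero_add, add_zero, le_refl]
  all_goals positivity

end Interlacing

section Nodes

variable {n : ℕ} (S : DiscreteString n)

namespace DiscreteString

instance isFiniteMeasure_g : IsFiniteMeasure S.g := by
  have hfin (i : Fin n) : IsFiniteMeasure (ENNReal.ofReal (S.mass i) • Measure.dirac (S.pos i)) :=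
    Measure.smul_finite _ ENNReal.ofReal_ne_top
  rw [g, ← Measure.sum_fintype]
  infer_instance

theorem ae_g_of_forall_pos {p : ℝ → Prop} (h : ∀ i, p (S.pos i)) : ∀ᵐ ξ ∂S.g, p ξ := by
  rw [g, ← Measure.sum_fintype, Measure.ae_sum_iff]
  refine fun i => Measure.ae_smul_measure ?_ _
  rw [ae_dirac_eq]
  exact h i

theorem pos_mem_Icc (i : Fin n) : S.pos i ∈ Icc (0 : ℝ) 1 :=
  ⟨(S.pos_pos i).le, S.pos_le_one i⟩

/-- The sequence `0, ξ_1, …, ξ_n, 1, 1, …`. -/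
noncomputable def node : ℕ → ℝ
  | 0 => 0
  | k + 1 => if h : k < n then S.pos ⟨k, h⟩ else 1

/-- The mass that is met on the way from `S.node k` to `S.node (k + 1)`. It is zero for `k ≥ n`,
also when the last mass sits at `1`: that mass is met on arrival at `S.node n`. -/
noncomputable def nodeMass (k : ℕ) : ℝ :=
  if h : k < n then S.mass ⟨k, h⟩ else 0

theorem node_succ_coe (i : Fin n) : S.node (i + 1) = S.pos i :=
  dif_pos i.2

theorem node_succ_of_le {k : ℕ} (hk : n ≤ k) : S.node (k + 1) = 1 :=
  dif_neg hk.not_gt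

theorem nodeMass_coe (i : Fin n) : S.nodeMass i = S.mass i :=
  dif_pos i.2

theorem nodeMass_of_le {k : ℕ} (hk : n ≤ k) : S.nodeMass k = 0 :=
  dif_neg hk.not_gt

theorem nodeMass_pos {k : ℕ} (hk : k < n) : 0 < S.nodeMass k :=
  (S.mass_pos ⟨k, hk⟩).trans_eq (S.nodeMass_coe ⟨k, hk⟩).symm

theorem nodeMass_nonneg (k : ℕ) : 0 ≤ S.nodeMass k := by
  rcases lt_or_ge k n with hk | hk
  · exact (S.nodeMass_pos hk).le
  · exact (S.nodeMass_of_le hk).ge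

theorem node_lt_pos_iff {k : ℕ} {j : Fin n} : S.node k < S.pos j ↔ k ≤ j := by
  cases k with
  | zero => exact iff_of_true (S.pos_pos j) (Nat.zero_le _)
  | succ k =>
    rcases lt_or_ge k n with hk | hk
    · rw [S.node_succ_coe ⟨k, hk⟩, S.pos_strictMono.lt_iff_lt, Fin.lt_def, Nat.succ_le_iff]
    · rw [S.node_succ_of_le hk]
      exact iff_of_false (S.pos_le_one j).not_gt (by omega)

theorem pos_mem_Ioc_node_iff {k : ℕ} {j : Fin n} :
    S.pos j ∈ Ioc (S.node k) (S.node (k + 1)) ↔ (j : ℕ) = k := by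
  rw [mem_Ioc, S.node_lt_pos_iff, ← not_lt (a := S.node _), S.node_lt_pos_iff]
  omega

theorem node_mem_Icc (k : ℕ) : S.node k ∈ Icc (0 : ℝ) 1 := by
  cases k with
  | zero => exact left_mem_Icc.2 zero_le_one
  | succ k =>
    rcases lt_or_ge k n with hk | hk
    · exact S.node_succ_coe ⟨k, hk⟩ ▸ S.pos_mem_Icc _
    · rw [S.node_succ_of_le hk]
      exact right_mem_Icc.2 zero_le_one

theorem node_lt_succ {k : ℕ} (hk : k < n) : S.node k < S.node (k + 1) :=
  (S.node_lt_pos_iff.2 le_rfl).trans_eq (S.node_succ_coe ⟨k, hk⟩).symm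

theorem node_le_succ (k : ℕ) : S.node k ≤ S.node (k + 1) := by
  rcases lt_or_ge k n with hk | hk
  · exact (S.node_lt_succ hk).le
  · exact S.node_succ_of_le hk ▸ (S.node_mem_Icc k).2

theorem Nondegenerate.node_lt_one (hS : S.Nondegenerate) : S.node n < 1 := by
  cases n with
  | zero => exact zero_lt_one
  | succ k => exact (S.node_succ_coe (Fin.last k)).trans_lt (hS _)

theorem setIntegral_g_eq_zero {s : Set ℝ} (hs : MeasurableSet s) (f : ℝ → ℂ)
    (h : ∀ i, S.pos i ∉ s) : ∫ t in s, f t ∂S.g = 0 := by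
  simp [S.setIntegral_g f hs, h]

theorem setIntegral_g_Ioc_node (f : ℝ → ℂ) (k : ℕ) :
    ∫ t in Ioc (S.node k) (S.node (k + 1)), f t ∂S.g = S.nodeMass k * f (S.node (k + 1)) := by
  rcases lt_or_ge k n with hk | hk
  · lift k to Fin n using hk
    simp only [S.setIntegral_g f measurableSet_Ioc, S.pos_mem_Ioc_node_iff, Fin.val_inj]
    simp [S.node_succ_coe, S.nodeMass_coe]
  · rw [S.nodeMass_of_le hk, Complex.ofReal_zero, zero_mul]
    exact S.setIntegral_g_eq_zero measurableSet_Ioc f fun j h =>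
      (j.2.trans_le hk).ne (S.pos_mem_Ioc_node_iff.1 h)

theorem sum_nodeMass_mul (f : ℝ → ℂ) :
    ∑ k ∈ Finset.range (n + 1), S.nodeMass k * f (S.node (k + 1)) =
      ∑ i, S.mass i * f (S.pos i) := by
  rw [Finset.sum_range_succ, S.nodeMass_of_le le_rfl, Complex.ofReal_zero, zero_mul, add_zero,
    Finset.sum_range]
  simp only [S.nodeMass_coe, S.node_succ_coe]

theorem setIntegral_g_Icc (f : ℝ → ℂ) :
    ∫ ξ in Icc (0 : ℝ) 1, f ξ ∂S.g = ∑ i, S.mass i * f (S.pos i) := by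
  simp [S.setIntegral_g f measurableSet_Icc, S.pos_mem_Icc]

/-- The values of `(u, u', u'')` at `S.node k` for the solution of `u''' = T u dg` with data
`(0, 0, v)` at `0`, where `T` is a linear map in place of multiplication by a number. -/
noncomputable def state {M : Type*} [AddCommGroup M] [Module ℝ M] (T : M →ₗ[ℝ] M) (v : M) :
    ℕ → Fin 3 → M
  | 0 => ![0, 0, v]
  | k + 1 => jump T (S.nodeMass k) (propagate (S.node (k + 1) - S.node k) (state T v k))

theorem map_state {M N : Type*} [AddCommGroup M] [Module ℝ M] [AddCommGroup N] [Module ℝ N]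
    {E : M →ₗ[ℝ] N} {T : M →ₗ[ℝ] M} {T' : N →ₗ[ℝ] N} (hE : ∀ x, E (T x) = T' (E x)) (v : M)
    (k : ℕ) : E ∘ S.state T v k = S.state T' (E v) k := by
  induction k with
  | zero =>
    funext a
    fin_cases a <;> simp [state]
  | succ k ih => rw [state, state, map_jump hE, map_propagate, ih]

theorem interlaced_state {T : ℝ × ℝ →ₗ[ℝ] ℝ × ℝ} (hT : ∀ u, 0 ≤ bracket u (T u)) {v : ℝ × ℝ}
    (hv : 0 < bracket v (T v)) (hn : 0 < n) (k : ℕ) : Interlaced T (S.state T v (k + 1)) := by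
  induction k with
  | zero => exact Interlaced.initial hv (sub_pos.2 (S.node_lt_succ hn)) (S.nodeMass_pos hn)
  | succ k ih =>
    exact (ih.propagate hT (sub_nonneg.2 (S.node_le_succ _))).jump hT (S.nodeMass_nonneg _)

end DiscreteString

variable {S} {w w' : ℂ} {U V : Fin 3 → ℝ → ℂ}

theorem IsSolution.two_eq_on_Ico_node (h : IsSolution S.g w U) (k : ℕ) {t : ℝ}
    (ht : t ∈ Ico (S.node k) (S.node (k + 1))) : U 2 t = U 2 (S.node k) := by
  have hmass (j : Fin n) : S.pos j ∉ Ioc (S.node k) t := fun hj => by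
    obtain rfl := S.pos_mem_Ioc_node_iff.1 ⟨hj.1, hj.2.trans ht.2.le⟩
    exact (hj.2.trans_lt ht.2).ne (S.node_succ_coe j).symm
  rw [h.two_eq_add (S.node_mem_Icc k).1 ht.1 (ht.2.le.trans (S.node_mem_Icc _).2),
    S.setIntegral_g_eq_zero measurableSet_Ioc _ hmass, mul_zero, add_zero]

theorem IsSolution.apply_node_succ (h : IsSolution S.g w U) (k : ℕ) :
    (U · (S.node (k + 1))) = jump (LinearMap.mulLeft ℝ w) (S.nodeMass k)
      (propagate (S.node (k + 1) - S.node k) (U · (S.node k))) := by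
  have hk := (S.node_mem_Icc k).1
  have hk' := (S.node_mem_Icc (k + 1)).2
  have hle := S.node_le_succ k
  have h0 := h.zero_eq_of_two_eq_const hk hk' (fun _ => h.two_eq_on_Ico_node k)
    (right_mem_Icc.2 hle)
  have h1 := h.one_eq_of_two_eq_const hk hk' (fun _ => h.two_eq_on_Ico_node k)
    (right_mem_Icc.2 hle)
  have h2 := h.two_eq_add hk hle hk'
  rw [S.setIntegral_g_Ioc_node, h0] at h2
  funext a
  fin_cases a <;> simp [jump, propagate, h0, h1, h2]
  all_goals ring

theorem IsSolution.apply_node (h : IsSolution S.g w U) (h0 : U 0 0 = 0) (h1 : U 1 0 = 0) (k : ℕ) :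
    (U · (S.node k)) = S.state (LinearMap.mulLeft ℝ w) (U 2 0) k := by
  induction k with
  | zero =>
    funext a
    fin_cases a <;> simp [DiscreteString.state, DiscreteString.node, h0, h1]
  | succ k ih => rw [h.apply_node_succ, ih, DiscreteString.state]

theorem IsSolution.concomitant_one_sub_concomitant_zero (hU : IsSolution S.g w U)
    (hV : IsSolution S.g w' V) :
    concomitant (U · 1) (V · 1) - concomitant (U · 0) (V · 0) =
      (w + w') * S.pairing (U 0) (V 0) := by
  let c (k : ℕ) : ℂ := concomitant (U · (S.node k)) (V · (S.node k))
  have hstep (k : ℕ) : c (k + 1) - c k =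
      (w + w') * (S.nodeMass k * (U 0 (S.node (k + 1)) * V 0 (S.node (k + 1)))) := by
    have hU0 := congrFun (hU.apply_node_succ k) 0
    have hV0 := congrFun (hV.apply_node_succ k) 0
    simp only [c]
    rw [hU.apply_node_succ, hV.apply_node_succ, concomitant_jump, concomitant_propagate]
    simp only [jump, Matrix.cons_val_zero] at hU0 hV0
    rw [← hU0, ← hV0, Complex.real_smul]
    ring
  have hsum := Finset.sum_range_sub c (n + 1)
  simp only [hstep, ← Finset.mul_sum] at hsum
  rw [S.sum_nodeMass_mul fun ξ => U 0 ξ * V 0 ξ, ← S.setIntegral_g_Icc fun ξ => U 0 ξ * V 0 ξ]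
    at hsum
  simp only [c, S.node_succ_of_le le_rfl] at hsum
  exact hsum.symm

end Nodes

section CharacteristicPolynomials

variable {n : ℕ} (S : DiscreteString n)

theorem natDegree_propagate_le (l : ℝ) {s : Fin 3 → ℝ[X]} {d : ℕ} (hs : ∀ a, (s a).natDegree ≤ d)
    (a : Fin 3) : (propagate l s a).natDegree ≤ d := by
  have hsmul (c : ℝ) (b : Fin 3) : (c • s b).natDegree ≤ d :=
    (natDegree_smul_le c (s b)).trans (hs b)
  fin_cases a
  · exact natDegree_add_le_of_degree_le
      (natDegree_add_le_of_degree_le (hs 0) (hsmul l 1)) (hsmul (l ^ 2 / 2) 2)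
  · exact natDegree_add_le_of_degree_le (hs 1) (hsmul l 2)
  · exact hs 2

theorem coeff_propagate_nonneg {l : ℝ} (hl : 0 ≤ l) {s : Fin 3 → ℝ[X]} {i : ℕ}
    (hs : ∀ a, 0 ≤ (s a).coeff i) (a : Fin 3) : 0 ≤ (propagate l s a).coeff i := by
  have h0 := hs 0
  have h1 := hs 1
  have h2 := hs 2
  fin_cases a <;> simp only [propagate, Fin.zero_eta, Fin.mk_one, Fin.reduceFinMk,
    Matrix.cons_val, coeff_add, coeff_smul, smul_eq_mul] <;> positivity

theorem coeff_propagate_pos {l : ℝ} (hl : 0 < l) {s : Fin 3 → ℝ[X]} {i : ℕ}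
    (hs : ∀ a, 0 ≤ (s a).coeff i) (hs2 : 0 < (s 2).coeff i) (a : Fin 3) :
    0 < (propagate l s a).coeff i := by
  have h0 := hs 0
  have h1 := hs 1
  fin_cases a <;> simp only [propagate, Fin.zero_eta, Fin.mk_one, Fin.reduceFinMk,
    Matrix.cons_val, coeff_add, coeff_smul, smul_eq_mul] <;> positivity

theorem aeval_complex_ofReal (p : ℝ[X]) (x : ℝ) : aeval (x : ℂ) p = p.eval x :=
  aeval_algebraMap_apply_eq_algebraMap_eval x p

namespace DiscreteString

/-- The polynomials `P_{k,a}` with `∂_ξ^a φ(ξ; z) = P_{k,a}(-z)` at `ξ = S.node k`. -/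
noncomputable def statePoly (k : ℕ) : Fin 3 → ℝ[X] :=
  S.state (LinearMap.mulLeft ℝ X) 1 k

/-- The characteristic polynomial of type `a`, in the variable `-z`: its zeros are the negatives of
the points of `S.spectrum a`. -/
noncomputable def charPoly (a : Fin 3) : ℝ[X] :=
  S.statePoly (n + 1) a

theorem map_statePoly {N : Type*} [AddCommGroup N] [Module ℝ N] {E : ℝ[X] →ₗ[ℝ] N}
    {T : N →ₗ[ℝ] N} (hE : ∀ f, E (X * f) = T (E f)) (k : ℕ) (a : Fin 3) :
    E (S.statePoly k a) = S.state T (E 1) k a :=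
  congrFun (S.map_state hE 1 k) a

theorem statePoly_succ (k : ℕ) : S.statePoly (k + 1) = jump (LinearMap.mulLeft ℝ X) (S.nodeMass k)
    (propagate (S.node (k + 1) - S.node k) (S.statePoly k)) := rfl

theorem statePoly_succ_two (k : ℕ) : S.statePoly (k + 1) 2 =
    S.statePoly k 2 + S.nodeMass k • (X * S.statePoly (k + 1) 0) := rfl

theorem charPoly_eq_propagate : S.charPoly = propagate (1 - S.node n) (S.statePoly n) := by
  funext a
  rw [charPoly, statePoly_succ, S.nodeMass_of_le le_rfl, S.node_succ_of_le le_rfl]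
  fin_cases a <;> simp [jump, propagate]

theorem natDegree_statePoly_le (k : ℕ) (a : Fin 3) : (S.statePoly k a).natDegree ≤ k := by
  induction k generalizing a with
  | zero => fin_cases a <;> simp [statePoly, state]
  | succ k ih =>
    have hprop := natDegree_propagate_le (S.node (k + 1) - S.node k) ih
    fin_cases a
    · exact (hprop 0).trans k.le_succ
    · exact (hprop 1).trans k.le_succ
    · exact natDegree_add_le_of_degree_le ((ih 2).trans k.le_succ)
        ((natDegree_smul_le _ _).trans ((natDegree_mul_le_of_le natDegree_X_le (hprop 0)).trans_eq
          (Nat.add_comm 1 k)))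

theorem coeff_statePoly_nonneg (k : ℕ) (a : Fin 3) (i : ℕ) : 0 ≤ (S.statePoly k a).coeff i := by
  induction k generalizing a i with
  | zero =>
    fin_cases a <;> simp only [statePoly, state, Fin.zero_eta, Fin.mk_one, Fin.reduceFinMk,
      Matrix.cons_val, coeff_zero, coeff_one]
    all_goals positivity
  | succ k ih =>
    have hprop (a i) : 0 ≤ (propagate (S.node (k + 1) - S.node k) (S.statePoly k) a).coeff i :=
      coeff_propagate_nonneg (sub_nonneg.2 (S.node_le_succ k)) (fun a => ih a i) a
    fin_cases a
    · exact hprop 0 i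
    · exact hprop 1 i
    · simp only [Fin.reduceFinMk, statePoly_succ_two, coeff_add, coeff_smul, smul_eq_mul]
      refine add_nonneg (ih 2 i) (mul_nonneg (S.nodeMass_nonneg k) ?_)
      cases i with
      | zero => rw [coeff_X_mul_zero]
      | succ i => exact (hprop 0 i).trans_eq (coeff_X_mul _ _).symm

theorem coeff_statePoly_two_pos {k : ℕ} (hk : k ≤ n) : 0 < (S.statePoly k 2).coeff k := by
  induction k with
  | zero => simp [statePoly, state]
  | succ k ih =>
    have h0 : 0 < (S.statePoly (k + 1) 0).coeff k :=
      coeff_propagate_pos (sub_pos.2 (S.node_lt_succ hk)) (S.coeff_statePoly_nonneg k · k)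
        (ih (k.le_succ.trans hk)) 0
    rw [statePoly_succ_two, coeff_add, coeff_smul, coeff_X_mul, smul_eq_mul]
    exact add_pos_of_nonneg_of_pos (S.coeff_statePoly_nonneg k 2 (k + 1))
      (mul_pos (S.nodeMass_pos hk) h0)

variable {a : Fin 3}

theorem natDegree_charPoly (ha : S.Nondegenerate ∨ a = 2) : (S.charPoly a).natDegree = n := by
  rw [charPoly_eq_propagate]
  refine le_antisymm (natDegree_propagate_le _ (S.natDegree_statePoly_le n) a)
    (le_natDegree_of_ne_zero (ne_of_gt ?_))
  rcases ha with hS | rfl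
  · exact coeff_propagate_pos (sub_pos.2 hS.node_lt_one) (S.coeff_statePoly_nonneg n · n)
      (S.coeff_statePoly_two_pos le_rfl) a
  · exact S.coeff_statePoly_two_pos le_rfl

theorem pos_of_aeval_charPoly_eq_zero {x : ℂ} (h : aeval x (S.charPoly a) = 0) : 0 < n := by
  refine Nat.pos_of_ne_zero ?_
  rintro rfl
  rw [charPoly_eq_propagate] at h
  fin_cases a <;> simp [propagate, statePoly, state, node] at h

theorem aeval_charPoly_ne_zero_of_im_pos {x : ℂ} (hx : 0 < x.im) (a : Fin 3) :
    aeval x (S.charPoly a) ≠ 0 := by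
  intro h
  -- Multiplication by `x` turns the plane `ℂ = ℝ × ℝ` counterclockwise.
  let T : ℝ × ℝ →ₗ[ℝ] ℝ × ℝ := Complex.equivRealProdLm.conj (LinearMap.mulLeft ℝ x)
  let E : ℝ[X] →ₗ[ℝ] ℝ × ℝ := Complex.equivRealProdLm.toLinearMap ∘ₗ (aeval x).toLinearMap
  have hE (f : ℝ[X]) : E (X * f) = T (E f) := by
    simp [E, T, LinearEquiv.conj_apply]
  have hT (u : ℝ × ℝ) : bracket u (T u) = x.im * (u.1 ^ 2 + u.2 ^ 2) := by
    simp [bracket_apply, T, LinearEquiv.conj_apply]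
    ring
  have hinter : Interlaced T (S.state T (E 1) (n + 1)) :=
    S.interlaced_state (fun u => by rw [hT]; positivity)
      (by rw [hT]; simpa [E] using hx) (S.pos_of_aeval_charPoly_eq_zero h) n
  apply hinter.ne_zero a
  rw [← S.map_statePoly hE]
  exact (congrArg Complex.equivRealProdLm h).trans (map_zero _)

theorem im_eq_zero_of_aeval_charPoly_eq_zero {x : ℂ} (h : aeval x (S.charPoly a) = 0) :
    x.im = 0 := by
  have hconj : aeval (starRingEnd ℂ x) (S.charPoly a) = 0 := by rw [aeval_conj, h, map_zero]
  refine le_antisymm (not_lt.1 fun hx => S.aeval_charPoly_ne_zero_of_im_pos hx a h)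
    (not_lt.1 fun hx => S.aeval_charPoly_ne_zero_of_im_pos (x := starRingEnd ℂ x) ?_ a hconj)
  simpa using hx

theorem interlaced_charPoly_derivative (hn : 0 < n) (x : ℝ) :
    ∃ T, Interlaced T fun a => ((S.charPoly a).eval x, (derivative (S.charPoly a)).eval x) := by
  -- `E f` encodes the dual number `f(x) + ε f'(x)`, and `T` is multiplication by `x + ε`.
  let T : ℝ × ℝ →ₗ[ℝ] ℝ × ℝ :=
    (x • LinearMap.fst ℝ ℝ ℝ).prod (LinearMap.fst ℝ ℝ ℝ + x • LinearMap.snd ℝ ℝ ℝ)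
  let E : ℝ[X] →ₗ[ℝ] ℝ × ℝ := (leval x).prod (leval x ∘ₗ derivative)
  have hE (f : ℝ[X]) : E (X * f) = T (E f) := by
    simp [E, T]
  have hT (u : ℝ × ℝ) : bracket u (T u) = u.1 ^ 2 := by
    simp [bracket_apply, T]
    ring
  have hinter : Interlaced T (S.state T (E 1) (n + 1)) :=
    S.interlaced_state (fun u => by rw [hT]; positivity) (by rw [hT]; simp [E]) hn n
  rw [← funext (S.map_statePoly hE (n + 1))] at hinter
  exact ⟨T, hinter⟩

theorem exists_real_of_aeval_charPoly_eq_zero {x : ℂ} (h : aeval x (S.charPoly a) = 0) :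
    ∃ y : ℝ, x = y ∧ (S.charPoly a).eval y = 0 := by
  lift x to ℝ using S.im_eq_zero_of_aeval_charPoly_eq_zero h
  rw [aeval_complex_ofReal] at h
  exact ⟨x, rfl, Complex.ofReal_eq_zero.1 h⟩

theorem aeval_derivative_charPoly_ne_zero {x : ℂ} (h : aeval x (S.charPoly a) = 0) :
    aeval x (derivative (S.charPoly a)) ≠ 0 := by
  obtain ⟨y, rfl, hy⟩ := S.exists_real_of_aeval_charPoly_eq_zero h
  obtain ⟨T, hT⟩ := S.interlaced_charPoly_derivative (S.pos_of_aeval_charPoly_eq_zero h) y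
  rw [aeval_complex_ofReal]
  exact fun hd => hT.ne_zero a (Prod.ext hy (Complex.ofReal_eq_zero.1 hd))

theorem separable_charPoly (a : Fin 3) : (S.charPoly a).Separable := by
  rw [Separable, isCoprime_iff_aeval_ne_zero_of_isAlgClosed ℝ ℂ]
  exact fun x => or_iff_not_imp_left.2 fun hx =>
    S.aeval_derivative_charPoly_ne_zero (not_not.1 hx)

theorem eval_charPoly_one_mul_eval_derivative_charPoly_two_pos {x : ℝ}
    (h : (S.charPoly 2).eval x = 0) :
    0 < (S.charPoly 1).eval x * (derivative (S.charPoly 2)).eval x := by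
  have hn : 0 < n := S.pos_of_aeval_charPoly_eq_zero (x := x) (by rw [aeval_complex_ofReal, h]; rfl)
  obtain ⟨T, hT⟩ := S.interlaced_charPoly_derivative hn x
  simpa [bracket_apply, h] using hT.one_two

end DiscreteString

end CharacteristicPolynomials

section Spectra

variable {n : ℕ} {S : DiscreteString n} {w : ℂ} {U : Fin 3 → ℝ → ℂ}

theorem IsSolution.apply_node_eq_aeval (h : IsSolution S.g w U) (h0 : U 0 0 = 0) (h1 : U 1 0 = 0)
    (k : ℕ) (a : Fin 3) : U a (S.node k) = U 2 0 * aeval w (S.statePoly k a) := by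
  let E : ℝ[X] →ₗ[ℝ] ℂ := LinearMap.mulLeft ℝ (U 2 0) ∘ₗ (aeval w).toLinearMap
  have hE (f : ℝ[X]) : E (X * f) = LinearMap.mulLeft ℝ w (E f) := by
    simp [E, mul_left_comm]
  have hE1 : E 1 = U 2 0 := by simp [E]
  have hstate := S.map_statePoly hE k a
  rw [hE1] at hstate
  exact (congrFun (h.apply_node h0 h1 k) a).trans hstate.symm

theorem IsSolution.apply_one_eq_aeval (h : IsSolution S.g w U) (h0 : U 0 0 = 0) (h1 : U 1 0 = 0)
    (a : Fin 3) : U a 1 = U 2 0 * aeval w (S.charPoly a) := by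
  rw [← S.node_succ_of_le le_rfl, h.apply_node_eq_aeval h0 h1, DiscreteString.charPoly]

theorem IsSolution.zero_eq_zero_of_two_zero_eq_zero (h : IsSolution S.g w U) (h0 : U 0 0 = 0)
    (h1 : U 1 0 = 0) (h2 : U 2 0 = 0) {t : ℝ} (ht : t ∈ Icc (0 : ℝ) 1) : U 0 t = 0 := by
  have hpos (i : Fin n) : U 0 (S.pos i) = 0 := by
    rw [← S.node_succ_coe, h.apply_node_eq_aeval h0 h1, h2, zero_mul]
  rw [h.zero_eq_of_ae_eq_zero (S.ae_g_of_forall_pos hpos) ht, h0, h1, h2]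
  simp

theorem IsSolution.exists_zero_ne_zero (h : IsSolution S.g w U) (h2 : U 2 0 ≠ 0)
    (h0 : U 0 0 = 0) (h1 : U 1 0 = 0) : ∃ t ∈ Icc (0 : ℝ) 1, U 0 t ≠ 0 := by
  by_contra! hzero
  have hone := h.zero_eq_of_ae_eq_zero
    (S.ae_g_of_forall_pos fun i => hzero _ (S.pos_mem_Icc i)) (right_mem_Icc.2 zero_le_one)
  rw [hzero 1 (right_mem_Icc.2 zero_le_one), h0, h1] at hone
  exact h2 (by simpa using hone)

theorem concomitant_adjointInitial (a : Fin 3) (v : Fin 3 → ℂ) :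
    concomitant (adjointInitial a) v = (-1) ^ (a : ℕ) * v a := by
  fin_cases a <;> simp [concomitant, adjointInitial]

namespace DiscreteString

variable (S) (a : Fin 3) (z z' : ℂ)

theorem phi_node (k : ℕ) : S.phi z a (S.node k) = aeval (-z) (S.statePoly k a) := by
  obtain ⟨h, hinit⟩ := S.phi_spec z
  simpa [hinit] using h.apply_node_eq_aeval (hinit 0) (hinit 1) k a

theorem phi_one : S.phi z a 1 = aeval (-z) (S.charPoly a) := by
  rw [← S.node_succ_of_le le_rfl, phi_node, charPoly]

variable {a z z'}

theorem mem_spectrum_iff : z ∈ S.spectrum a ↔ aeval (-z) (S.charPoly a) = 0 := by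
  constructor
  · rintro ⟨U, hU, h0, h1, ha, t, ht, hne⟩
    rw [hU.apply_one_eq_aeval h0 h1] at ha
    exact (mul_eq_zero.1 ha).resolve_left fun h2 =>
      hne (hU.zero_eq_zero_of_two_zero_eq_zero h0 h1 h2 ht)
  · intro hz
    obtain ⟨hphi, hinit⟩ := S.phi_spec z
    exact ⟨S.phi z, hphi, hinit 0, hinit 1, (S.phi_one a z).trans hz,
      hphi.exists_zero_ne_zero (by simp [hinit]) (hinit 0) (hinit 1)⟩

theorem phi_one_eq_zero (hz : z ∈ S.spectrum a) : S.phi z a 1 = 0 :=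
  (S.phi_one a z).trans (S.mem_spectrum_iff.1 hz)

variable (a)

theorem spectrum_eq_image_rootSet : S.spectrum a = Neg.neg '' (S.charPoly a).rootSet ℂ := by
  ext z
  rw [mem_spectrum_iff, image_neg_eq_neg, Set.mem_neg,
    mem_rootSet_of_ne (S.separable_charPoly a).ne_zero]

theorem finite_spectrum : (S.spectrum a).Finite := by
  rw [spectrum_eq_image_rootSet]
  exact (rootSet_finite _ _).image _

variable {a} in
theorem card_spectrum (ha : S.Nondegenerate ∨ a = 2) : Nat.card (S.spectrum a) = n := by
  rw [spectrum_eq_image_rootSet, Nat.card_image_of_injective neg_injective,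
    Nat.card_eq_fintype_card,
    card_rootSet_eq_natDegree (S.separable_charPoly a) (IsAlgClosed.splits _),
    S.natDegree_charPoly ha]

variable (z z')

theorem sub_mul_pairing_phiStar_phi : (z' - z) * S.pairing (S.phiStar a z' 0) (S.phi z 0) =
    (-1) ^ (a : ℕ) * S.phi z a 1 - S.phiStar a z' 0 0 := by
  obtain ⟨hstar, hfinal⟩ := S.phiStar_spec a z'
  obtain ⟨hphi, hinit⟩ := S.phi_spec z
  rw [sub_eq_add_neg z' z, ← hstar.concomitant_one_sub_concomitant_zero hphi, funext hfinal,
    funext hinit, concomitant_adjointInitial]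
  simp [concomitant]

theorem sub_mul_pairing_phiStar_phi_eq_sub :
    (z' - z) * S.pairing (S.phiStar a z' 0) (S.phi z 0) =
      (-1) ^ (a : ℕ) * (S.phi z a 1 - S.phi z' a 1) := by
  have hdiag := S.sub_mul_pairing_phiStar_phi a z' z'
  rw [sub_self, zero_mul] at hdiag
  rw [sub_mul_pairing_phiStar_phi]
  linear_combination -hdiag

variable {a z z'}

theorem pairing_phiStar_phi_eq_zero (hz : z ∈ S.spectrum a) (hz' : z' ∈ S.spectrum a)
    (hne : z' ≠ z) : S.pairing (S.phiStar a z' 0) (S.phi z 0) = 0 := by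
  have h := S.sub_mul_pairing_phiStar_phi_eq_sub a z z'
  rw [S.phi_one_eq_zero hz, S.phi_one_eq_zero hz', sub_zero, mul_zero] at h
  exact (mul_eq_zero.1 h).resolve_left (sub_ne_zero.2 hne)

theorem differentiable_pairing_phi (f : ℝ → ℂ) :
    Differentiable ℂ fun s : ℂ => S.pairing f (S.phi s 0) := by
  simp only [pairing, setIntegral_g_Icc, ← node_succ_coe, phi_node]
  have hpoly (p : ℝ[X]) : Differentiable ℂ fun s : ℂ => aeval (-s) p :=
    (p.differentiable_aeval (𝕜 := ℂ)).comp (differentiable_neg (𝕜 := ℂ))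
  fun_prop

variable (a z)

theorem hasDerivAt_phi_one :
    HasDerivAt (fun s => S.phi s a 1) (-aeval (-z) (derivative (S.charPoly a))) z := by
  simp only [phi_one]
  simpa [Function.comp_def] using
    (Polynomial.hasDerivAt_aeval (S.charPoly a) (-z)).comp z (hasDerivAt_neg z)

theorem hasDerivAt_phi_one_pairing :
    HasDerivAt (fun s => S.phi s a 1)
      (-((-1) ^ (a : ℕ) * S.pairing (S.phiStar a z 0) (S.phi z 0))) z := by
  have hphi (s : ℂ) : S.phi s a 1 = S.phi z a 1 +
      (-1) ^ (a : ℕ) * ((z - s) * S.pairing (S.phiStar a z 0) (S.phi s 0)) := by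
    rw [sub_mul_pairing_phiStar_phi_eq_sub, ← mul_assoc, ← mul_pow]
    simp
  have hpairing := (S.differentiable_pairing_phi (S.phiStar a z 0) z).hasDerivAt
  rw [funext hphi]
  simpa using ((((hasDerivAt_id z).const_sub z).mul hpairing).const_mul
    ((-1) ^ (a : ℕ))).const_add (S.phi z a 1)

theorem pairing_phiStar_phi_self : S.pairing (S.phiStar a z 0) (S.phi z 0) =
    (-1) ^ (a : ℕ) * aeval (-z) (derivative (S.charPoly a)) := by
  have h := neg_injective ((S.hasDerivAt_phi_one_pairing a z).unique (S.hasDerivAt_phi_one a z))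
  rw [← h, ← mul_assoc, ← mul_pow]
  simp

variable {a z}

theorem pairing_phiStar_phi_self_ne_zero (hz : z ∈ S.spectrum a) :
    S.pairing (S.phiStar a z 0) (S.phi z 0) ≠ 0 := by
  rw [pairing_phiStar_phi_self]
  exact mul_ne_zero (by simp) (S.aeval_derivative_charPoly_ne_zero (S.mem_spectrum_iff.1 hz))

end DiscreteString

end Spectra

section Inversion

variable {n : ℕ} (S : DiscreteString n)

namespace DiscreteString

variable (a : Fin 3)

noncomputable instance fintypeSpectrum : Fintype (S.spectrum a) :=
  (S.finite_spectrum a).fintype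

/-- The matrix of the transform of type `a`, acting on the values at the points of `S.pos`. -/
noncomputable def fourierMatrix : Matrix (S.spectrum a) (Fin n) ℂ :=
  Matrix.of fun z i => (-1) ^ (a : ℕ) * (S.mass i * S.phiStar a z 0 (S.pos i))

/-- The matrix of `S.invFourier a`, giving the values at the points of `S.pos`. -/
noncomputable def invFourierMatrix : Matrix (Fin n) (S.spectrum a) ℂ :=
  Matrix.of fun i z =>
    (-1) ^ (a : ℕ) * (S.phi z 0 (S.pos i) / S.pairing (S.phiStar a z 0) (S.phi z 0))

theorem fourierMatrix_mul_invFourierMatrix : S.fourierMatrix a * S.invFourierMatrix a = 1 := by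
  ext z z'
  have hsign : ((-1 : ℂ) ^ (a : ℕ)) * (-1) ^ (a : ℕ) = 1 := by
    rw [← mul_pow]
    simp
  have hentry : (S.fourierMatrix a * S.invFourierMatrix a) z z' =
      S.pairing (S.phiStar a z 0) (S.phi z' 0) / S.pairing (S.phiStar a z' 0) (S.phi z' 0) := by
    rw [Matrix.mul_apply, pairing, setIntegral_g_Icc, Finset.sum_div]
    refine Finset.sum_congr rfl fun i _ => ?_
    simp only [fourierMatrix, invFourierMatrix, Matrix.of_apply]
    linear_combination ((S.mass i : ℂ) * S.phiStar a z 0 (S.pos i) *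
      (S.phi z' 0 (S.pos i) / S.pairing (S.phiStar a z' 0) (S.phi z' 0))) * hsign
  rw [hentry, Matrix.one_apply]
  split_ifs with hz
  · rw [hz, div_self (S.pairing_phiStar_phi_self_ne_zero z'.2)]
  · rw [S.pairing_phiStar_phi_eq_zero z'.2 z.2 (Subtype.coe_injective.ne hz), zero_div]

variable {a} in
theorem invFourierMatrix_mul_fourierMatrix (ha : S.Nondegenerate ∨ a = 2) :
    S.invFourierMatrix a * S.fourierMatrix a = 1 := by
  have hcard : Fintype.card (S.spectrum a) = Fintype.card (Fin n) := by
    rw [← Nat.card_eq_fintype_card, S.card_spectrum ha, Fintype.card_fin]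
  exact (Matrix.mul_eq_one_comm_of_equiv (Fintype.equivOfCardEq hcard)).1
    (S.fourierMatrix_mul_invFourierMatrix a)

theorem fourier_eq_mulVec (f : ℝ → ℂ) (z : S.spectrum a) :
    S.fourier a f z = (S.fourierMatrix a).mulVec (f ∘ S.pos) z := by
  rw [fourier, setIntegral_g_Icc, Matrix.mulVec, dotProduct, Finset.mul_sum]
  exact Finset.sum_congr rfl fun i _ => by
    simp only [fourierMatrix, Matrix.of_apply, Function.comp_apply]
    ring

theorem invFourier_eq_sum (F : ℂ → ℂ) (ξ : ℝ) :
    S.invFourier a F ξ = (-1) ^ (a : ℕ) * ∑ z : S.spectrum a,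
      F z * (S.phi z 0 ξ / S.pairing (S.phiStar a z 0) (S.phi z 0)) := by
  rw [← tsum_fintype (L := .unconditional _), invFourier, nu]
  congr 1
  simpa using integral_sum_dirac (x := ((↑) : S.spectrum a → ℂ)) (c := fun _ => 1)
    (f := fun z => F z * (S.phi z 0 ξ / S.pairing (S.phiStar a z 0) (S.phi z 0))) (by simp)

theorem invFourier_comp_pos (F : ℂ → ℂ) :
    S.invFourier a F ∘ S.pos = (S.invFourierMatrix a).mulVec fun z => F z := by
  funext i
  rw [Function.comp_apply, invFourier_eq_sum, Matrix.mulVec, dotProduct, Finset.mul_sum]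
  exact Finset.sum_congr rfl fun z _ => by
    simp only [invFourierMatrix, Matrix.of_apply]
    ring

variable {a} {z : ℂ}

theorem fourier_invFourier (F : ℂ → ℂ) (hz : z ∈ S.spectrum a) :
    S.fourier a (S.invFourier a F) z = F z := by
  rw [S.fourier_eq_mulVec a _ ⟨z, hz⟩, invFourier_comp_pos, Matrix.mulVec_mulVec,
    fourierMatrix_mul_invFourierMatrix, Matrix.one_mulVec]

theorem invFourier_fourier (ha : S.Nondegenerate ∨ a = 2) (f : ℝ → ℂ) (i : Fin n) :
    S.invFourier a (S.fourier a f) (S.pos i) = f (S.pos i) := by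
  have hcomp : S.invFourier a (S.fourier a f) ∘ S.pos = f ∘ S.pos := by
    rw [invFourier_comp_pos, funext (S.fourier_eq_mulVec a f), Matrix.mulVec_mulVec,
      S.invFourierMatrix_mul_fourierMatrix ha, Matrix.one_mulVec]
  exact congrFun hcomp i

theorem ae_eq_invFourier_fourier (ha : S.Nondegenerate ∨ a = 2) (f : ℝ → ℂ) :
    ∀ᵐ ξ ∂S.g, f ξ = S.invFourier a (S.fourier a f) ξ :=
  S.ae_g_of_forall_pos fun i => (S.invFourier_fourier ha f i).symm

theorem weight_eq (z : ℂ) :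
    S.weight z = aeval (-z) (S.charPoly 1) / aeval (-z) (derivative (S.charPoly 2)) := by
  rw [weight, (S.hasDerivAt_phi_one 2 z).deriv, phi_one, neg_div_neg_eq]

theorem exists_pos_weight_eq (hz : z ∈ S.spectrum 2) : ∃ b : ℝ, 0 < b ∧ S.weight z = b := by
  obtain ⟨x, hx, hroot⟩ := S.exists_real_of_aeval_charPoly_eq_zero (S.mem_spectrum_iff.1 hz)
  refine ⟨(S.charPoly 1).eval x / (derivative (S.charPoly 2)).eval x, ?_, ?_⟩
  · rw [div_pos_iff, ← mul_pos_iff]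
    exact S.eval_charPoly_one_mul_eval_derivative_charPoly_two_pos hroot
  · rw [weight_eq, hx, aeval_complex_ofReal, aeval_complex_ofReal, Complex.ofReal_div]

theorem weight_re_pos (hz : z ∈ S.spectrum 2) : 0 < (S.weight z).re := by
  obtain ⟨b, hb, h⟩ := S.exists_pos_weight_eq hz
  rwa [h]

theorem weight_im (hz : z ∈ S.spectrum 2) : (S.weight z).im = 0 := by
  obtain ⟨b, -, h⟩ := S.exists_pos_weight_eq hz
  rw [h, Complex.ofReal_im]

theorem phi_one_one_ne_zero (hz : z ∈ S.spectrum 2) : S.phi z 1 1 ≠ 0 := by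
  intro h
  have hpos := S.weight_re_pos hz
  simp [weight, h] at hpos

theorem weight_eq_phi_div_pairing (z : ℂ) :
    S.weight z = S.phi z 1 1 / S.pairing (S.phiStar 2 z 0) (S.phi z 0) := by
  rw [weight_eq, phi_one, pairing_phiStar_phi_self]
  simp

theorem invFourierBeta_eq_invFourier (F : ℂ → ℂ) : S.invFourierBeta F = S.invFourier 2 F := by
  funext ξ
  rw [invFourierBeta, beta, integral_sum_dirac fun _ => ENNReal.ofReal_ne_top, tsum_fintype,
    invFourier_eq_sum, Fin.val_two, neg_one_sq, one_mul]
  refine Finset.sum_congr rfl fun z _ => ?_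
  have hphi := S.phi_one_one_ne_zero z.2
  have hweight : ((S.weight z).re : ℂ) = S.weight z :=
    Complex.ext rfl (S.weight_im z.2).symm
  rw [ENNReal.toReal_ofReal (S.weight_re_pos z.2).le, Complex.real_smul, hweight,
    weight_eq_phi_div_pairing]
  field_simp

end DiscreteString

end Inversion

end CubicString

theorem mainTheorem9_general {n : ℕ} (S : CubicString.DiscreteString n) :
    (∀ a : Fin 3,
      (S.spectrum a).Finite ∧
      (∀ z ∈ S.spectrum a, S.pairing (S.phiStar a z 0) (S.phi z 0) ≠ 0) ∧
      ((S.Nondegenerate ∨ a = 2) → ∀ f : ℝ → ℂ,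
        ∀ᵐ ξ ∂S.g, f ξ = S.invFourier a (S.fourier a f) ξ) ∧
      (∀ F : ℂ → ℂ, ∀ z ∈ S.spectrum a, S.fourier a (S.invFourier a F) z = F z)) ∧
    ((∀ z ∈ S.spectrum 2, S.phi z 1 1 ≠ 0 ∧ 0 < (S.weight z).re ∧ (S.weight z).im = 0) ∧
      (∀ f : ℝ → ℂ, ∀ᵐ ξ ∂S.g, f ξ = S.invFourierBeta (S.fourier 2 f) ξ) ∧
      (∀ F : ℂ → ℂ, ∀ z ∈ S.spectrum 2, S.fourier 2 (S.invFourierBeta F) z = F z)) := by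
  simp only [S.invFourierBeta_eq_invFourier]
  exact ⟨fun a => ⟨S.finite_spectrum a, fun z => S.pairing_phiStar_phi_self_ne_zero,
      S.ae_eq_invFourier_fourier, fun F z => S.fourier_invFourier F⟩,
    fun z hz => ⟨S.phi_one_one_ne_zero hz, S.weight_re_pos hz, S.weight_im hz⟩,
    S.ae_eq_invFourier_fourier (.inr rfl), fun F z => S.fourier_invFourier F⟩

theorem mainTheorem9 {n : ℕ} (S : CubicString.DiscreteString n) :
    (∀ a : Fin 3, (S.Nondegenerate ∨ a = 2) →
      (S.spectrum a).Finite ∧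
      (∀ z ∈ S.spectrum a, S.pairing (S.phiStar a z 0) (S.phi z 0) ≠ 0) ∧
      (∀ f : ℝ → ℂ, MeasureTheory.MemLp f 2 S.g →
        ∀ᵐ ξ ∂S.g, f ξ = S.invFourier a (S.fourier a f) ξ) ∧
      (∀ F : ℂ → ℂ, ∀ z ∈ S.spectrum a, S.fourier a (S.invFourier a F) z = F z)) ∧
    ((∀ z ∈ S.spectrum 2, S.phi z 1 1 ≠ 0 ∧ 0 < (S.weight z).re ∧ (S.weight z).im = 0) ∧
      (∀ f : ℝ → ℂ, MeasureTheory.MemLp f 2 S.g →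
        ∀ᵐ ξ ∂S.g, f ξ = S.invFourierBeta (S.fourier 2 f) ξ) ∧
      (∀ F : ℂ → ℂ, ∀ z ∈ S.spectrum 2, S.fourier 2 (S.invFourierBeta F) z = F z)) := by
  obtain ⟨htransform, hweight, hinv, hinv'⟩ := mainTheorem9_general S
  exact ⟨fun a ha => ⟨(htransform a).1, (htransform a).2.1,
    fun f _ => (htransform a).2.2.1 ha f, (htransform a).2.2.2⟩, hweight, fun f _ => hinv f, hinv'⟩
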